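/- A length function on a group $G$ is a function $l : G \to [0,\infty)$ such that $l(g^k) = |k|\, l(g)$ for all $g \in G$, $k \in \mathbb{Z}$; $l(aga^{-1}) = l(g)$ for all $a, g \in G$; and $l(ab) \le l(a) + l(b)$ whenever $a, b \in G$ commute. It is purely positive if $l(g) > 0$ for every element $g$ of infinite order. Theorem. Let $G$ be a group having a finite-index subgroup $H \le G$ and a subnormal series $$1 = H_m \vartriangleleft H_{m-1} \vartriangleleft \cdots \vartriangleleft H_0 = H$$ such that (i) for each $0 \le i < m$, every finitely generated subgroup of $H_i/H_{i+1}$ has a purely positive length function; and (ii) for each $0 \le i < m$, every torsion abelian subgroup of every finitely generated subgroup of $H_i/H_{i+1}$ is finitely generated. Let $R$ be a finitely generated associative (not necessarily commutative) ring with identity, let $n \ge 3$, and let $E_n(R) \le \mathrm{GL}_n(R)$ be the subgroup generated by the elementary matrices $e_{ij}(r)$ ($i \ne j$, $r \in R$), where $e_{ij}(r)$ has $1$s on the diagonal, $r$ in position $(i,j)$ and $0$ elsewhere. Let $\Gamma \le E_n(R)$ be a subgroup of finite index. Then every group homomorphism $f : \Gamma \to G$ has finite image. -/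

import Mathlib

/-- A length function on a group `G`: a function `l : G → [0, ∞)` that is homogeneous on cyclic
subgroups, conjugation invariant, and subadditive on commuting pairs. -/
structure IsLengthFunction {G : Type*} [Group G] (l : G → ℝ) : Prop where
  nonneg : ∀ g : G, 0 ≤ l g
  zpow : ∀ (g : G) (k : ℤ), l (g ^ k) = |(k : ℝ)| * l g
  conj : ∀ a g : G, l (a * g * a⁻¹) = l g
  mul_le : ∀ a b : G, Commute a b → l (a * b) ≤ l a + l b

/-- `G` has a purely positive length function: one that is positive on every element of
infinite order. -/
def HasPurelyPositiveLength (G : Type*) [Group G] : Prop :=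
  ∃ l : G → ℝ, IsLengthFunction l ∧ ∀ g : G, ¬ IsOfFinOrder g → 0 < l g

/-- A subnormal series `1 = H_m ⊲ H_{m-1} ⊲ ⋯ ⊲ H_0 = H` of a subgroup `H` of `G`. -/
structure SubnormalSeries {G : Type*} [Group G] (H : Subgroup G) where
  length : ℕ
  term : Fin (length + 1) → Subgroup G
  term_zero : term 0 = H
  term_last : term (Fin.last length) = ⊥
  succ_le : ∀ i : Fin length, term i.succ ≤ term i.castSucc
  normal : ∀ i : Fin length, ((term i.succ).subgroupOf (term i.castSucc)).Normal

/-- The successive quotient `H_i / H_{i+1}` of a subnormal series. -/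
abbrev SubnormalSeries.Factor {G : Type*} [Group G] {H : Subgroup G} (s : SubnormalSeries H)
    (i : Fin s.length) : Type _ :=
  ↥(s.term i.castSucc) ⧸ (s.term i.succ).subgroupOf (s.term i.castSucc)

instance SubnormalSeries.factorGroup {G : Type*} [Group G] {H : Subgroup G}
    (s : SubnormalSeries H) (i : Fin s.length) : Group (s.Factor i) :=
  haveI := s.normal i
  QuotientGroup.Quotient.group ((s.term i.succ).subgroupOf (s.term i.castSucc))

/-- Every finitely generated subgroup of every successive quotient has a purely positive
length function. -/
def SubnormalSeries.IsPolyPositive {G : Type*} [Group G] {H : Subgroup G}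
    (s : SubnormalSeries H) : Prop :=
  ∀ (i : Fin s.length) (Q : Subgroup (s.Factor i)), Q.FG → HasPurelyPositiveLength Q

/-- Every torsion abelian subgroup `A` of every finitely generated subgroup `Q` of every
successive quotient is finitely generated. -/
def SubnormalSeries.TorsionAbelianFG {G : Type*} [Group G] {H : Subgroup G}
    (s : SubnormalSeries H) : Prop :=
  ∀ (i : Fin s.length) (Q : Subgroup (s.Factor i)), Q.FG →
    ∀ A : Subgroup (s.Factor i), A ≤ Q →
      (∀ a ∈ A, ∀ b ∈ A, a * b = b * a) → (∀ a ∈ A, IsOfFinOrder a) → A.FG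

/-- The elementary matrix `e_{ij}(r) = 1 + r E_{ij}` with `i ≠ j`, as an invertible matrix over a
not necessarily commutative ring. -/
def elementaryMatrix {n : ℕ} {R : Type*} [Ring R] (i j : Fin n) (hij : i ≠ j) (r : R) :
    Matrix.GeneralLinearGroup (Fin n) R where
  val := 1 + Matrix.single i j r
  inv := 1 + Matrix.single i j (-r)
  val_inv := by
    rw [mul_add, add_mul, add_mul, Matrix.single_mul_single_of_ne _ _ _ _ hij.symm]
    simp [add_assoc, ← Matrix.single_add]
  inv_val := by
    rw [mul_add, add_mul, add_mul, Matrix.single_mul_single_of_ne _ _ _ _ hij.symm]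
    simp [add_assoc, ← Matrix.single_add]

/-- The elementary group `E_n(R)`, the subgroup of `GL_n(R)` generated by the elementary
matrices. -/
def elementaryGroup (n : ℕ) (R : Type*) [Ring R] : Subgroup (Matrix.GeneralLinearGroup (Fin n) R) :=
  Subgroup.closure {x | ∃ (i j : Fin n) (hij : i ≠ j) (r : R), x = elementaryMatrix i j hij r}

/-!
Descending along the subnormal series, it suffices to treat a homomorphism `φ : Γ → Q` from a
finite-index subgroup `Γ` of `E_n(R)` to a group `Q` satisfying the two hypotheses on the factors
(`finite_range_of_purelyPositive`); its kernel is then the finite-index subgroup for the next step.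

The commutator relation `[e_{ik}(a), e_{kj}(b)] = e_{ij}(ab)` makes elements of root subgroups central
in Heisenberg groups. If `z = [x, y]` commutes with `x` and `y`, then
`zⁿ = (xⁿ y x⁻ⁿ) y⁻¹` has length at most `2 l(y)` for every `n`, so `l(z) = 0`
(`IsLengthFunction.commutator_eq_zero`). Hence `φ` has torsion image on `Γ ∩ g e_{ij}(R) g⁻¹`; the
image is also abelian, so it is finitely generated and finite. Consequently the normal core `K` of
`ker φ` in `E_n(R)` meets every root subgroup in finite index.

Such a normal subgroup has finite index (`finite_quotient_of_finiteIndex_root`). The `r ∈ R` with all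
`e_{ij}(r) ∈ K` form a two-sided ideal of finite index, so `E_n(R) / K` is generated by elements
`x_{ij}(a)`, with `a` in a finite ring `A`, satisfying the Steinberg relations. A group `S` of this kind
is finite (`IsSteinbergFamily.finite`). Let `T` be the subgroup normalizing every root subgroup. A
finite ring has stable range one (`exists_isUnit_add_mul`), which yields a Gauss decomposition of the
subgroup generated by two opposite root subgroups, with the diagonal part in `T`: an element of that
subgroup acts on pairs of root elements `x_{ik}(u) x_{jk}(w)` by a `2 × 2` matrix, and a diagonal
action means that the element normalizes all root subgroups. This extends to `S = U L U T` with `U`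
and `L` the finite upper and lower unipotent subgroups, so each root element has only finitely many
conjugates, the center of `S` has finite index, and Schur's theorem shows that the perfect group `S`
is finite.

Finite generation of `R` enters only through the finite generation of `E_n(R)`
(`elementaryGroup_fg`), which makes the images of `Γ` finitely generated.
-/

/-! ### Length functions vanish on Heisenberg-central commutators -/

/-- If `z = [x, y]` commutes with `x` and `y`, then `zⁿ` is the product of the commuting elements
`xⁿ y x⁻ⁿ` and `y⁻¹`, whose lengths do not depend on `n`; hence `z` has length zero. -/
theorem IsLengthFunction.commutator_eq_zero {G : Type*} [Group G] {l : G → ℝ}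
    (hl : IsLengthFunction l) {x y z : G} (hz : x * y = z * y * x)
    (hzx : Commute z x) (hzy : Commute z y) : l z = 0 := by
  have hpow : ∀ k : ℕ, x ^ k * y = z ^ k * y * x ^ k := by
    intro k
    induction k with
    | zero => simp
    | succ k ih =>
      calc x ^ (k + 1) * y = x ^ k * (x * y) := by rw [pow_succ, mul_assoc]
        _ = (x ^ k * z) * y * x := by rw [hz]; simp only [mul_assoc]
        _ = z * (x ^ k * y) * x := by
          rw [← (hzx.pow_right k).eq]; simp only [mul_assoc]
        _ = z ^ (k + 1) * y * x ^ (k + 1) := by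
          rw [ih, pow_succ' z, pow_succ x]; simp only [mul_assoc]
  have hinv : l y⁻¹ = l y := by simpa using hl.zpow y (-1)
  have hbound : ∀ k : ℕ, (k : ℝ) * l z ≤ 2 * l y := by
    intro k
    have h1 : x ^ k * y * (x ^ k)⁻¹ = z ^ k * y := by
      rw [hpow k]; group
    have h2 : z ^ k = (x ^ k * y * (x ^ k)⁻¹) * y⁻¹ := by rw [h1]; group
    have h3 : Commute (x ^ k * y * (x ^ k)⁻¹) y⁻¹ := by
      rw [h1]
      exact ((hzy.pow_left k).mul_left (Commute.refl y)).inv_right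
    have h4 := hl.mul_le _ _ h3
    rw [← h2, hl.conj, hinv] at h4
    have h5 : l (z ^ k) = k * l z := by simpa using hl.zpow z k
    linarith
  refine le_antisymm (not_lt.mp fun hpos => ?_) (hl.nonneg z)
  obtain ⟨k, hk⟩ := exists_nat_gt (2 * l y / l z)
  rw [div_lt_iff₀ hpos] at hk
  linarith [hbound k]

/-! ### Finite rings have stable range one -/

section StableRange

variable {A : Type*} [Ring A] [Finite A]

/-- For endomorphisms `x ↦ x b` of a finite semisimple ring, a nonzero complement `D` of the image
receives a nonzero map from the kernel. Both `ker ⊕ im` and `D ⊕ im` are isomorphic to `A`, so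
`|Hom(ker, D)| = |Hom(D, D)|`. -/
theorem exists_ne_zero_ker_to_complement [IsSemisimpleRing A] (f : A →ₗ[A] A)
    (D : Submodule A A) (hD : IsCompl f.range D) (hD0 : D ≠ ⊥) :
    ∃ h : f.ker →ₗ[A] D, h ≠ 0 := by
  have hfin : ∀ M : Submodule A A, Finite (M →ₗ[A] D) := fun M =>
    Finite.of_injective (fun g : M →ₗ[A] D => (g : M → D)) DFunLike.coe_injective
  obtain ⟨C, hC⟩ := exists_isCompl f.ker
  let e : C ≃ₗ[A] f.range :=
    (Submodule.quotientEquivOfIsCompl _ _ hC).symm.trans f.quotKerEquivRange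
  let e₁ : (f.ker × C) ≃ₗ[A] A := Submodule.prodEquivOfIsCompl _ _ hC
  let e₂ : (D × f.range) ≃ₗ[A] A := Submodule.prodEquivOfIsCompl _ _ hD.symm
  let e₃ : (f.ker × C) ≃ₗ[A] (D × f.range) := e₁.trans e₂.symm
  have hcard : Nat.card (f.ker →ₗ[A] D) * Nat.card (f.range →ₗ[A] D) =
      Nat.card (D →ₗ[A] D) * Nat.card (f.range →ₗ[A] D) := by
    rw [← Nat.card_congr (LinearEquiv.congrLeft D ℤ e).toEquiv, ← Nat.card_prod,
      Nat.card_congr (LinearEquiv.congrLeft D ℤ e).toEquiv, ← Nat.card_prod,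
      Nat.card_congr (LinearMap.coprodEquiv ℤ).toEquiv,
      Nat.card_congr (LinearMap.coprodEquiv ℤ).toEquiv]
    exact Nat.card_congr (LinearEquiv.congrLeft D ℤ e₃).toEquiv
  have := hfin f.range
  have := hfin D
  have := hfin f.ker
  have hcard' := Nat.eq_of_mul_eq_mul_right Nat.card_pos hcard
  by_contra! hzero
  have hsub : Nat.card (D →ₗ[A] D) = 1 := by
    rw [← hcard', Nat.card_eq_one_iff_unique]
    exact ⟨⟨fun a b => by rw [hzero a, hzero b]⟩, ⟨0⟩⟩
  obtain ⟨hs, -⟩ := Nat.card_eq_one_iff_unique.mp hsub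
  apply hD0
  rw [Submodule.eq_bot_iff]
  intro d hd
  have := LinearMap.congr_fun (hs.elim (LinearMap.id : D →ₗ[A] D) 0) ⟨d, hd⟩
  simpa using this

theorem exists_isUnit_add_mul_of_isSemisimpleRing [IsSemisimpleRing A] {a c p q : A}
    (h : p * a + q * c = 1) : ∃ t, IsUnit (a + t * c) := by
  let f : A → (A →ₗ[A] A) := fun t => LinearMap.toSpanSingleton A A (a + t * c)
  have hf : ∀ t x, f t x = x * (a + t * c) := fun t x => rfl
  -- The kernel of right multiplication by `a + t c` is smallest possible for this `t`.
  obtain ⟨t, ht⟩ := Finite.exists_min fun t => Nat.card (f t).ker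
  refine ⟨t, ?_⟩
  have hunit : (f t).range = ⊤ → IsUnit (a + t * c) := by
    intro htop
    obtain ⟨y, hy⟩ := LinearMap.range_eq_top.mp htop 1
    exact IsUnit.of_mul_eq_one y (mul_eq_one_comm.mp hy)
  set C : Submodule A A := Submodule.span A {c}
  obtain ⟨E, hE⟩ := exists_isCompl ((f t).range ⊓ C)
  have htop : (f t).range ⊔ C = ⊤ := by
    rw [Submodule.eq_top_iff']
    intro x
    have h1 : x = (x * p) * (a + t * c) + (x * q - x * p * t) * c := by
      calc x = x * (p * a + q * c) := by rw [h, mul_one]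
        _ = _ := by noncomm_ring
    rw [h1]
    exact Submodule.add_mem_sup ⟨x * p, rfl⟩
      (Submodule.mem_span_singleton.mpr ⟨_, rfl⟩)
  have hcompl : IsCompl (f t).range (E ⊓ C) := by
    constructor
    · rw [disjoint_iff, ← inf_assoc, inf_right_comm, hE.inf_eq_bot]
    · rw [codisjoint_iff, eq_top_iff, ← htop]
      refine sup_le le_sup_left ?_
      have h2 : C = ((f t).range ⊓ C) ⊔ (E ⊓ C) := by
        rw [← sup_inf_assoc_of_le E (inf_le_right : (f t).range ⊓ C ≤ C), hE.sup_eq_top,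
          top_inf_eq]
      exact h2.le.trans (sup_le_sup_right inf_le_left _)
  by_cases hD0 : E ⊓ C = ⊥
  · apply hunit
    simpa [hD0] using hcompl.sup_eq_top
  obtain ⟨g, hg⟩ := exists_ne_zero_ker_to_complement (f t) _ hcompl hD0
  obtain ⟨K, hK⟩ := exists_isCompl (f t).ker
  let g' : A →ₗ[A] A := (Submodule.subtype _).comp (g.comp (Submodule.projectionOnto _ _ hK))
  have hgD : ∀ x, g' x ∈ E ⊓ C := fun x => (g _).2
  obtain ⟨s, hs⟩ := Submodule.mem_span_singleton.mp (hgD 1).2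
  have hsum : ∀ x, f (t + s) x = f t x + g' x := by
    intro x
    have h3 : g' x = x * g' 1 := by
      rw [← smul_eq_mul, ← map_smul, smul_eq_mul, mul_one]
    rw [h3, ← hs, hf, hf, smul_eq_mul]
    noncomm_ring
  have hker : ∀ x, f (t + s) x = 0 → f t x = 0 ∧ g' x = 0 := by
    intro x hx
    rw [hsum] at hx
    have h4 : f t x = - g' x := eq_neg_of_add_eq_zero_left hx
    have h5 : f t x ∈ (f t).range ⊓ (E ⊓ C) :=
      ⟨⟨x, rfl⟩, h4 ▸ neg_mem (hgD x)⟩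
    rw [hcompl.inf_eq_bot, Submodule.mem_bot] at h5
    exact ⟨h5, by simpa [h5] using h4⟩
  -- Adding `s` shrinks the kernel strictly, against the choice of `t`.
  exfalso
  obtain ⟨k, hk⟩ : ∃ k, g k ≠ 0 := by
    by_contra! hcon
    exact hg (LinearMap.ext hcon)
  have hlt : Nat.card (f (t + s)).ker < Nat.card (f t).ker := by
    refine Set.ncard_lt_ncard (s := ((f (t + s)).ker : Set A)) (t := ((f t).ker : Set A)) ?_
      (Set.toFinite _)
    refine (Set.ssubset_iff_of_subset fun x hx => (hker x hx).1).mpr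
      ⟨k, k.2, fun hmem => hk ?_⟩
    have h6 := (hker k hmem).2
    simpa [g'] using h6
  exact absurd (ht (t + s)) (not_le.mpr hlt)

/-- **Stable range one** for finite rings, deduced from the semisimple case because units lift
along the quotient by the nilpotent Jacobson radical. -/
theorem exists_isUnit_add_mul {a c p q : A} (h : p * a + q * c = 1) :
    ∃ t, IsUnit (a + t * c) := by
  let J := Ring.jacobson A
  have : IsSemisimpleRing (A ⧸ J) := IsSemiprimaryRing.isSemisimpleRing
  have : Finite (A ⧸ J) := Quotient.finite _
  let π := Ideal.Quotient.mk J
  have hπ : π p * π a + π q * π c = 1 := by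
    rw [← map_mul, ← map_mul, ← map_add, h, map_one]
  obtain ⟨t', u, hu⟩ := exists_isUnit_add_mul_of_isSemisimpleRing hπ
  obtain ⟨t, rfl⟩ := Ideal.Quotient.mk_surjective t'
  obtain ⟨v, hv⟩ := Ideal.Quotient.mk_surjective (I := J) (↑u⁻¹ : A ⧸ J)
  refine ⟨t, ?_⟩
  have hmem : v * (a + t * c) - 1 ∈ J := by
    rw [← Ideal.Quotient.eq, map_mul, map_add, map_mul, map_one]
    change π v * (π a + π t * π c) = 1
    rw [← hu]
    change π v = _ at hv
    rw [hv, Units.inv_mul]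
  obtain ⟨N, hN⟩ : IsNilpotent J := IsSemiprimaryRing.isNilpotent
  have hnil : IsNilpotent (v * (a + t * c) - 1) := by
    refine ⟨N, ?_⟩
    have := Ideal.pow_mem_pow hmem N
    rwa [hN] at this
  have h1 : IsUnit (v * (a + t * c)) := by simpa using hnil.isUnit_one_add
  obtain ⟨w, hw⟩ := h1
  have h2 : (↑w⁻¹ * v) * (a + t * c) = 1 := by rw [mul_assoc, ← hw, Units.inv_mul]
  exact IsUnit.of_mul_eq_one _ (mul_eq_one_comm.mp h2)

end StableRange

/-! ### Steinberg families and the subgroups they span -/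

/-- A family `x i j : A → S` satisfying the Steinberg relations. The values `x i i` carry no
information. -/
structure IsSteinbergFamily {n : ℕ} {A S : Type*} [Ring A] [Group S]
    (x : Fin n → Fin n → A → S) : Prop where
  map_add : ∀ {i j}, i ≠ j → ∀ a b, x i j (a + b) = x i j a * x i j b
  commute : ∀ {i j k l}, i ≠ j → k ≠ l → j ≠ k → i ≠ l → ∀ a b, Commute (x i j a) (x k l b)
  mul_comm_mul : ∀ {i j k}, i ≠ j → j ≠ k → i ≠ k → ∀ a b,
    x i j a * x j k b = x i k (a * b) * x j k b * x i j a

/-- The subgroup generated by the root elements `x i j a` with `i ≠ j` and `P i j`. -/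
def rootSpan {n : ℕ} {A S : Type*} [Group S] (x : Fin n → Fin n → A → S)
    (P : Fin n → Fin n → Prop) : Subgroup S :=
  Subgroup.closure {g | ∃ i j a, i ≠ j ∧ P i j ∧ g = x i j a}

theorem Subgroup.finite_sup_of_le_normalizer {S : Type*} [Group S] (H N : Subgroup S)
    [Finite H] [Finite N] (h : H ≤ Subgroup.normalizer (N : Set S)) :
    Finite (H ⊔ N : Subgroup S) := by
  have : ((H ⊔ N : Subgroup S) : Set S).Finite := by
    rw [Subgroup.coe_mul_of_left_le_normalizer_right H N h]
    exact (Set.toFinite _).mul (Set.toFinite _)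
  exact this.to_subtype

theorem Fin.exists_ne_and_ne_of_three_le {n : ℕ} (hn : 3 ≤ n) (i j : Fin n) :
    ∃ k, k ≠ i ∧ k ≠ j := by
  obtain ⟨k, hk⟩ : ∃ k : Fin n, k ∉ ({i, j} : Finset (Fin n)) := by
    by_contra! h
    have h1 := Finset.card_le_card fun k (_ : k ∈ Finset.univ) => h k
    have h2 : Finset.card {i, j} ≤ 2 := Finset.card_le_two
    simp only [Finset.card_univ, Fintype.card_fin] at h1
    omega
  simp only [Finset.mem_insert, Finset.mem_singleton, not_or] at hk
  exact ⟨k, hk⟩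

section RootSpan

variable {n : ℕ} {A S : Type*} [Group S] {x : Fin n → Fin n → A → S}
  {P Q : Fin n → Fin n → Prop}

theorem mem_rootSpan {i j : Fin n} (hij : i ≠ j) (h : P i j) (a : A) : x i j a ∈ rootSpan x P :=
  Subgroup.subset_closure ⟨i, j, a, hij, h, rfl⟩

theorem rootSpan_le {N : Subgroup S} (h : ∀ i j, i ≠ j → P i j → ∀ a, x i j a ∈ N) :
    rootSpan x P ≤ N :=
  (Subgroup.closure_le _).mpr fun _ ⟨i, j, a, hij, hP, hg⟩ => hg ▸ h i j hij hP a

theorem rootSpan_mono (h : ∀ i j, P i j → Q i j) : rootSpan x P ≤ rootSpan x Q :=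
  rootSpan_le fun _ _ hij hP a => mem_rootSpan hij (h _ _ hP) a

end RootSpan

namespace IsSteinbergFamily

variable {n : ℕ} {A S : Type*} [Ring A] [Group S] {x : Fin n → Fin n → A → S}
  (hx : IsSteinbergFamily x)

include hx

theorem map_zero {i j : Fin n} (hij : i ≠ j) : x i j 0 = 1 := by
  simpa using hx.map_add hij 0 0

theorem map_neg {i j : Fin n} (hij : i ≠ j) (a : A) : x i j (-a) = (x i j a)⁻¹ := by
  rw [eq_inv_iff_mul_eq_one, ← hx.map_add hij, neg_add_cancel, hx.map_zero hij]

theorem commutator {i j k : Fin n} (hij : i ≠ j) (hjk : j ≠ k) (hik : i ≠ k) (a b : A) :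
    x i k (a * b) = x i j a * x j k b * (x i j a)⁻¹ * (x j k b)⁻¹ := by
  rw [hx.mul_comm_mul hij hjk hik]; group

/-- Conjugating the root subgroup `(p, q)` by the root subgroup `(k, l)` only produces the root
subgroups `(p, q)` and, when they make sense, `(k, q)` and `(p, l)`. -/
theorem conj_mem {N : Subgroup S} {k l p q : Fin n} (hkl : k ≠ l) (hpq : p ≠ q)
    (hne : ¬(q = k ∧ l = p)) (h0 : ∀ b, x p q b ∈ N) (h1 : l = p → ∀ b, x k q b ∈ N)
    (h2 : q = k → ∀ b, x p l b ∈ N) (a b : A) :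
    x k l a * x p q b * (x k l a)⁻¹ ∈ N := by
  by_cases hlp : l = p
  · subst hlp
    have hkq : k ≠ q := fun h => hne ⟨h.symm, rfl⟩
    rw [hx.mul_comm_mul hkl hpq hkq, mul_inv_cancel_right]
    exact mul_mem (h1 rfl _) (h0 _)
  by_cases hqk : q = k
  · subst hqk
    have hc := hx.mul_comm_mul hpq hkl (Ne.symm hlp) b a
    have : x q l a * x p q b * (x q l a)⁻¹ = (x p l (b * a))⁻¹ * x p q b := by
      rw [mul_inv_eq_iff_eq_mul, mul_assoc, hc]; group
    rw [this]
    exact mul_mem (inv_mem (h2 rfl _)) (h0 _)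
  · rw [(hx.commute hkl hpq hlp (Ne.symm hqk) a b).eq, mul_inv_cancel_right]
    exact h0 b

theorem rootSpan_le_normalizer {P Q : Fin n → Fin n → Prop}
    (h : ∀ k l p q, k ≠ l → p ≠ q → P k l → Q p q →
      ¬(q = k ∧ l = p) ∧ (l = p → Q k q) ∧ (q = k → Q p l)) :
    rootSpan x P ≤ Subgroup.normalizer (rootSpan x Q : Set S) := by
  refine rootSpan_le fun k l hkl hP => ?_
  have hconj : ∀ a, ∀ g ∈ rootSpan x Q, x k l a * g * (x k l a)⁻¹ ∈ rootSpan x Q := by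
    intro a
    have : rootSpan x Q ≤ (rootSpan x Q).comap (MulAut.conj (x k l a)).toMonoidHom := by
      refine rootSpan_le fun p q hpq hQ b => ?_
      obtain ⟨hne, h1, h2⟩ := h k l p q hkl hpq hP hQ
      exact hx.conj_mem hkl hpq hne (fun b => mem_rootSpan hpq hQ b)
        (fun e b => mem_rootSpan (fun e' => hne ⟨e'.symm, e⟩) (h1 e) b)
        (fun e b => mem_rootSpan (fun e' => hne ⟨e, e'.symm⟩) (h2 e) b) a b
    exact this
  intro a
  refine Subgroup.mem_normalizer_iff.mpr fun g => ⟨hconj a g, fun hg => ?_⟩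
  have := hconj (-a) _ hg
  rw [hx.map_neg hkl] at this
  simpa [mul_assoc] using this

theorem exists_eq_of_mem_rootSpan_singleton {i j : Fin n} (hij : i ≠ j) {g : S}
    (hg : g ∈ rootSpan x fun k l => k = i ∧ l = j) : ∃ a, g = x i j a := by
  induction hg using Subgroup.closure_induction with
  | mem _ h =>
    obtain ⟨k, l, a, -, ⟨rfl, rfl⟩, rfl⟩ := h
    exact ⟨a, rfl⟩
  | one => exact ⟨0, (hx.map_zero hij).symm⟩
  | mul _ _ _ _ h₁ h₂ =>
    obtain ⟨a, rfl⟩ := h₁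
    obtain ⟨b, rfl⟩ := h₂
    exact ⟨a + b, (hx.map_add hij a b).symm⟩
  | inv _ _ h =>
    obtain ⟨a, rfl⟩ := h
    exact ⟨-a, (hx.map_neg hij a).symm⟩

/-- The unipotent subgroup attached to a total order on the indices, encoded by an injection
`σ` into `ℕ`, is finite: it is exhausted by adding one root subgroup at a time, in an order in
which each new root subgroup normalizes what precedes it. -/
theorem finite_rootSpan_of_order [Finite A] (σ : Fin n → ℕ) (hσ : Function.Injective σ) :
    Finite (rootSpan x fun k l => σ l < σ k) := by
  let c : Fin n → Fin n → ℕ := fun k l => σ l * n + k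
  have hc : ∀ {k l p q}, c p q < c k l → σ q ≤ σ l := by
    intro k l p q h
    by_contra! hlt
    have h1 : (σ l + 1) * n ≤ σ q * n := Nat.mul_le_mul_right n hlt
    have h2 := k.2
    simp only [c] at h
    rw [add_mul, one_mul] at h1
    omega
  have hc' : ∀ {k l p q}, σ q < σ l → c p q < c k l := by
    intro k l p q h
    have h1 : (σ q + 1) * n ≤ σ l * n := Nat.mul_le_mul_right n h
    have h2 := p.2
    simp only [c]
    rw [add_mul, one_mul] at h1
    omega
  have hinj : ∀ {k l p q}, c k l = c p q → k = p ∧ l = q := by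
    intro k l p q h
    have hl : σ l = σ q := by
      rcases lt_trichotomy (σ l) (σ q) with h1 | h1 | h1
      · exact absurd h (hc' h1).ne
      · exact h1
      · exact absurd h (hc' h1).ne'
    refine ⟨Fin.ext ?_, hσ hl⟩
    simp only [c, hl] at h
    omega
  have key : ∀ m, Finite (rootSpan x fun k l => σ l < σ k ∧ c k l < m) := by
    intro m
    induction m with
    | zero =>
      have : (rootSpan x fun k l => σ l < σ k ∧ c k l < 0) = ⊥ :=
        le_bot_iff.mp (rootSpan_le fun _ _ _ h => absurd h.2 (Nat.not_lt_zero _))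
      rw [this]; infer_instance
    | succ m ih =>
      by_cases hm : ∃ k l, σ l < σ k ∧ c k l = m
      · obtain ⟨k, l, hlt, rfl⟩ := hm
        have hkl : k ≠ l := fun e => hlt.ne (e ▸ rfl)
        have hfin : Finite (rootSpan x fun k' l' => k' = k ∧ l' = l) :=
          ((Set.finite_range (x k l)).subset fun g hg => by
            obtain ⟨a, rfl⟩ := hx.exists_eq_of_mem_rootSpan_singleton hkl hg
            exact ⟨a, rfl⟩).to_subtype
        have hnorm := hx.rootSpan_le_normalizer (P := fun k' l' => k' = k ∧ l' = l)
          (Q := fun p q => σ q < σ p ∧ c p q < c k l) (by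
            rintro _ _ p q - - ⟨rfl, rfl⟩ ⟨hqp, hcc⟩
            have hle := hc hcc
            refine ⟨?_, ?_, ?_⟩
            · rintro ⟨rfl, rfl⟩; omega
            · rintro rfl; exact ⟨by omega, hc' hqp⟩
            · rintro rfl; omega)
        have := Subgroup.finite_sup_of_le_normalizer _ _ hnorm
        refine Finite.of_injective _ (Subgroup.inclusion_injective (rootSpan_le (N :=
          rootSpan x (fun k' l' => k' = k ∧ l' = l) ⊔
            rootSpan x fun p q => σ q < σ p ∧ c p q < c k l) ?_))
        rintro p q hpq ⟨hqp, hcc⟩ a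
        rcases Nat.lt_succ_iff_lt_or_eq.mp hcc with h | h
        · exact Subgroup.mem_sup_right (mem_rootSpan hpq ⟨hqp, h⟩ a)
        · exact Subgroup.mem_sup_left (mem_rootSpan hpq (hinj h) a)
      · refine Finite.of_injective _ (Subgroup.inclusion_injective (rootSpan_mono
          (Q := fun k l => σ l < σ k ∧ c k l < m) ?_))
        rintro p q ⟨hqp, hcc⟩
        refine ⟨hqp, (Nat.lt_succ_iff_lt_or_eq.mp hcc).resolve_right fun h => hm ⟨p, q, hqp, h⟩⟩
  obtain ⟨m, hm⟩ : ∃ m, ∀ k l, c k l < m := by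
    obtain ⟨m, hm⟩ := (Set.finite_range fun kl : Fin n × Fin n => c kl.1 kl.2).bddAbove
    exact ⟨m + 1, fun k l => Nat.lt_succ_of_le (hm ⟨(k, l), rfl⟩)⟩
  have := key m
  exact Finite.of_injective _ (Subgroup.inclusion_injective (rootSpan_mono
    (Q := fun k l => σ l < σ k ∧ c k l < m) fun k l h => ⟨h, hm k l⟩))

end IsSteinbergFamily

/-! ### Rank one subgroups and the torus -/

section Torus

variable {n : ℕ} {A S : Type*} [Group S]

/-- The elements of `S` normalizing every root subgroup. -/
def rootTorus (x : Fin n → Fin n → A → S) : Subgroup S where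
  carrier := {g | ∀ i j, i ≠ j → ∀ a,
    (∃ b, g * x i j a * g⁻¹ = x i j b) ∧ ∃ b, g⁻¹ * x i j a * g = x i j b}
  one_mem' := fun i j _ a => ⟨⟨a, by simp⟩, ⟨a, by simp⟩⟩
  mul_mem' := by
    intro g h hg hh i j hij a
    obtain ⟨b, hb⟩ := (hh i j hij a).1
    obtain ⟨b', hb'⟩ := (hg i j hij b).1
    obtain ⟨c, hc⟩ := (hg i j hij a).2
    obtain ⟨c', hc'⟩ := (hh i j hij c).2
    refine ⟨⟨b', ?_⟩, ⟨c', ?_⟩⟩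
    · rw [← hb', ← hb]; group
    · rw [← hc', ← hc]; group
  inv_mem' := by
    intro g hg i j hij a
    refine ⟨?_, ?_⟩
    · simpa using (hg i j hij a).2
    · simpa using (hg i j hij a).1

/-- The torus normalizes the span of any set of roots. -/
theorem rootTorus_le_normalizer (x : Fin n → Fin n → A → S) (P : Fin n → Fin n → Prop) :
    rootTorus x ≤ Subgroup.normalizer (rootSpan x P : Set S) := by
  have hconj : ∀ t ∈ rootTorus x, ∀ g ∈ rootSpan x P, t * g * t⁻¹ ∈ rootSpan x P := by
    intro t ht
    have : rootSpan x P ≤ (rootSpan x P).comap (MulAut.conj t).toMonoidHom := by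
      refine rootSpan_le fun p q hpq hP b => ?_
      obtain ⟨c, hc⟩ := (ht p q hpq b).1
      exact Subgroup.mem_comap.mpr (hc ▸ mem_rootSpan hpq hP c :
        t * x p q b * t⁻¹ ∈ rootSpan x P)
    exact this
  intro t ht
  refine Subgroup.mem_normalizer_iff.mpr fun g => ⟨hconj t ht g, fun hg => ?_⟩
  simpa [mul_assoc] using hconj t⁻¹ (inv_mem ht) _ hg

end Torus

section PairAction

open Matrix

variable {n : ℕ} {A S : Type*} [Ring A] [Group S]

/-- Conjugation by `g` acts on the pairs `x i k u * x j k w` as the matrix `M` acts on column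
vectors, and on the pairs `x k i u * x k j w` as `M⁻¹` acts on row vectors, for all indices `k`
outside `{i, j}`. -/
def ActsAs (x : Fin n → Fin n → A → S) (i j : Fin n) (g : S)
    (M : (Matrix (Fin 2) (Fin 2) A)ˣ) : Prop :=
  ∀ k, k ≠ i → k ≠ j → ∀ v : Fin 2 → A,
    g * (x i k (v 0) * x j k (v 1)) * g⁻¹ =
      x i k ((M.1 *ᵥ v) 0) * x j k ((M.1 *ᵥ v) 1) ∧
    g * (x k i (v 0) * x k j (v 1)) * g⁻¹ =
      x k i ((v ᵥ* M⁻¹.1) 0) * x k j ((v ᵥ* M⁻¹.1) 1)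

variable {x : Fin n → Fin n → A → S} {i j : Fin n}

theorem ActsAs.one : ActsAs x i j 1 1 := fun _ _ _ _ => by simp

theorem ActsAs.mul {g h : S} {M N : (Matrix (Fin 2) (Fin 2) A)ˣ} (hg : ActsAs x i j g M)
    (hh : ActsAs x i j h N) : ActsAs x i j (g * h) (M * N) := by
  intro k hki hkj v
  have e : ∀ y : S, g * h * y * (g * h)⁻¹ = g * (h * y * h⁻¹) * g⁻¹ := fun y => by group
  constructor
  · rw [e, (hh k hki hkj v).1, (hg k hki hkj _).1, mulVec_mulVec, Units.val_mul]
  · rw [e, (hh k hki hkj v).2, (hg k hki hkj _).2, vecMul_vecMul, _root_.mul_inv_rev, Units.val_mul]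

theorem ActsAs.inv {g : S} {M : (Matrix (Fin 2) (Fin 2) A)ˣ} (hg : ActsAs x i j g M) :
    ActsAs x i j g⁻¹ M⁻¹ := by
  intro k hki hkj v
  have e : ∀ y z : S, g * y * g⁻¹ = z → g⁻¹ * z * g⁻¹⁻¹ = y := by
    rintro y _ rfl; group
  constructor
  · apply e
    rw [(hg k hki hkj _).1, mulVec_mulVec, ← Units.val_mul, mul_inv_cancel, Units.val_one,
      one_mulVec]
  · apply e
    rw [(hg k hki hkj _).2, vecMul_vecMul, ← Units.val_mul, inv_mul_cancel, Units.val_one,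
      vecMul_one]

/-- The transvection `1 + a E₀₁` as a unit. -/
def upperUnit (a : A) : (Matrix (Fin 2) (Fin 2) A)ˣ where
  val := !![1, a; 0, 1]
  inv := !![1, -a; 0, 1]
  val_inv := by simp [one_fin_two]
  inv_val := by simp [one_fin_two]

/-- The transvection `1 + a E₁₀` as a unit. -/
def lowerUnit (a : A) : (Matrix (Fin 2) (Fin 2) A)ˣ where
  val := !![1, 0; a, 1]
  inv := !![1, 0; -a, 1]
  val_inv := by simp [one_fin_two]
  inv_val := by simp [one_fin_two]

theorem val_inv_upperUnit (a : A) : (upperUnit a)⁻¹.1 = !![1, -a; 0, 1] := rfl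

theorem val_inv_lowerUnit (a : A) : (lowerUnit a)⁻¹.1 = !![1, 0; -a, 1] := rfl

namespace IsSteinbergFamily

variable (hx : IsSteinbergFamily x)

include hx

theorem actsAs_upper (hij : i ≠ j) (a : A) : ActsAs x i j (x i j a) (upperUnit a) := by
  intro k hki hkj v
  constructor
  · have h1 : (upperUnit a).1 *ᵥ v = ![v 0 + a * v 1, v 1] := by
      ext r; fin_cases r <;> simp [upperUnit, mulVec, dotProduct, Fin.sum_univ_two]
    rw [h1]
    simp only [Matrix.cons_val_zero, Matrix.cons_val_one]
    rw [mul_inv_eq_iff_eq_mul, ← mul_assoc,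
      (hx.commute hij (Ne.symm hki) hij.symm (Ne.symm hki) a (v 0)).eq, mul_assoc,
      hx.mul_comm_mul hij (Ne.symm hkj) (Ne.symm hki), hx.map_add (Ne.symm hki)]
    simp only [mul_assoc]
  · have h1 : v ᵥ* (upperUnit a)⁻¹.1 = ![v 0, v 1 + v 0 * (-a)] := by
      ext r; fin_cases r <;>
        simp [val_inv_upperUnit, vecMul, dotProduct, Fin.sum_univ_two, add_comm]
    rw [h1]
    simp only [Matrix.cons_val_zero, Matrix.cons_val_one]
    have h2 := hx.mul_comm_mul hki hij hkj (v 0) a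
    rw [mul_inv_eq_iff_eq_mul, mul_neg, hx.map_add hkj, hx.map_neg hkj]
    have h3 := hx.commute hij hkj (Ne.symm hkj) hij a (v 1)
    have h4 := hx.commute hki hkj (Ne.symm hki) hkj (v 0) (v 0 * a)
    have h5 := hx.commute hij hkj (Ne.symm hkj) hij a (v 0 * a)
    have h6 : x i j a * x k i (v 0) = x k i (v 0) * (x k j (v 0 * a))⁻¹ * x i j a := by
      rw [(h4.inv_right).eq, mul_assoc, h2]; group
    have h7 := hx.commute hkj hkj (Ne.symm hkj) hkj (v 1) (v 0 * a)
    calc x i j a * (x k i (v 0) * x k j (v 1))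
        = (x k i (v 0) * (x k j (v 0 * a))⁻¹) * (x i j a * x k j (v 1)) := by
          rw [← mul_assoc, h6]; simp only [mul_assoc]
      _ = x k i (v 0) * ((x k j (v 0 * a))⁻¹ * x k j (v 1)) * x i j a := by
          rw [h3.eq]; simp only [mul_assoc]
      _ = _ := by rw [(h7.inv_right).eq]

theorem actsAs_lower (hij : i ≠ j) (a : A) : ActsAs x i j (x j i a) (lowerUnit a) := by
  intro k hki hkj v
  -- The two pair subgroups are commutative, so the roles of `i` and `j` may be exchanged.
  have hcol : ∀ a b, Commute (x i k a) (x j k b) :=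
    hx.commute (Ne.symm hki) (Ne.symm hkj) hkj (Ne.symm hki)
  have hrow : ∀ a b, Commute (x k i a) (x k j b) := hx.commute hki hkj (Ne.symm hki) hkj
  obtain ⟨h1, h2⟩ := hx.actsAs_upper hij.symm a k hkj hki ![v 1, v 0]
  constructor
  · rw [(hcol _ _).eq, (hcol _ _).eq]
    convert h1 using 3 <;>
      simp [upperUnit, lowerUnit, mulVec, dotProduct, Fin.sum_univ_two, add_comm]
  · rw [(hrow _ _).eq, (hrow _ _).eq]
    convert h2 using 3 <;>
      simp [val_inv_upperUnit, val_inv_lowerUnit, vecMul, dotProduct, Fin.sum_univ_two, add_comm]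

/-- Every element of the rank one subgroup generated by two opposite root subgroups acts through an
invertible `2 × 2` matrix. -/
theorem exists_actsAs (hij : i ≠ j) {g : S}
    (hg : g ∈ rootSpan x fun k l => (k = i ∧ l = j) ∨ (k = j ∧ l = i)) :
    ∃ M, ActsAs x i j g M := by
  induction hg using Subgroup.closure_induction with
  | mem _ h =>
    obtain ⟨k, l, a, -, ⟨rfl, rfl⟩ | ⟨rfl, rfl⟩, rfl⟩ := h
    · exact ⟨_, hx.actsAs_upper hij a⟩
    · exact ⟨_, hx.actsAs_lower hij a⟩
  | one => exact ⟨1, ActsAs.one⟩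
  | mul _ _ _ _ h₁ h₂ =>
    obtain ⟨M, hM⟩ := h₁
    obtain ⟨N, hN⟩ := h₂
    exact ⟨M * N, hM.mul hN⟩
  | inv _ _ h =>
    obtain ⟨M, hM⟩ := h
    exact ⟨M⁻¹, hM.inv⟩

theorem conj_root_of_actsAs_diagonal (hn : 3 ≤ n) (hij : i ≠ j) {g : S}
    (hg : g ∈ rootSpan x fun k l => (k = i ∧ l = j) ∨ (k = j ∧ l = i))
    {M : (Matrix (Fin 2) (Fin 2) A)ˣ} (hM : ActsAs x i j g M)
    (h01 : M.1 0 1 = 0) (h10 : M.1 1 0 = 0) (h01' : M⁻¹.1 0 1 = 0) (h10' : M⁻¹.1 1 0 = 0)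
    {p q : Fin n} (hpq : p ≠ q) (a : A) : ∃ b, g * x p q a * g⁻¹ = x p q b := by
  have hik : ∀ k, k ≠ i → k ≠ j → ∀ a, g * x i k a * g⁻¹ = x i k (M.1 0 0 * a) := by
    intro k hki hkj a
    have := (hM k hki hkj ![a, 0]).1
    simpa [mulVec, dotProduct, Fin.sum_univ_two, h10, hx.map_zero (Ne.symm hkj)] using this
  have hjk : ∀ k, k ≠ i → k ≠ j → ∀ a, g * x j k a * g⁻¹ = x j k (M.1 1 1 * a) := by
    intro k hki hkj a
    have := (hM k hki hkj ![0, a]).1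
    simpa [mulVec, dotProduct, Fin.sum_univ_two, h01, hx.map_zero (Ne.symm hki)] using this
  have hki : ∀ k, k ≠ i → k ≠ j → ∀ a, g * x k i a * g⁻¹ = x k i (a * M⁻¹.1 0 0) := by
    intro k hki hkj a
    have := (hM k hki hkj ![a, 0]).2
    simpa [vecMul, dotProduct, Fin.sum_univ_two, h01', hx.map_zero hkj] using this
  have hkj : ∀ k, k ≠ i → k ≠ j → ∀ a, g * x k j a * g⁻¹ = x k j (a * M⁻¹.1 1 1) := by
    intro k hki hkj a
    have := (hM k hki hkj ![0, a]).2
    simpa [vecMul, dotProduct, Fin.sum_univ_two, h10', hx.map_zero hki] using this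
  have hmul : ∀ y z : S, g * (y * z * y⁻¹ * z⁻¹) * g⁻¹ =
      (g * y * g⁻¹) * (g * z * g⁻¹) * (g * y * g⁻¹)⁻¹ * (g * z * g⁻¹)⁻¹ := fun y z => by group
  obtain ⟨k, hk1, hk2⟩ := Fin.exists_ne_and_ne_of_three_le hn i j
  by_cases hpi : p = i
  · subst hpi
    by_cases hqj : q = j
    · subst hqj
      have h1 := hx.commutator (Ne.symm hk1) hk2 hij a 1
      rw [mul_one] at h1
      exact ⟨M.1 0 0 * a * (1 * M⁻¹.1 1 1), by
        rw [h1, hmul, hik k hk1 hk2, hkj k hk1 hk2, ← hx.commutator (Ne.symm hk1) hk2 hij]⟩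
    · exact ⟨_, hik q hpq.symm hqj a⟩
  by_cases hpj : p = j
  · subst hpj
    by_cases hqi : q = i
    · subst hqi
      have h1 := hx.commutator (Ne.symm hk2) hk1 hij.symm a 1
      rw [mul_one] at h1
      exact ⟨M.1 1 1 * a * (1 * M⁻¹.1 0 0), by
        rw [h1, hmul, hjk k hk1 hk2, hki k hk1 hk2,
          ← hx.commutator (Ne.symm hk2) hk1 hij.symm]⟩
    · exact ⟨_, hjk q hqi hpq.symm a⟩
  by_cases hqi : q = i
  · subst hqi
    exact ⟨_, hki p hpi hpj a⟩
  by_cases hqj : q = j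
  · subst hqj
    exact ⟨_, hkj p hpi hpj a⟩
  · refine ⟨a, ?_⟩
    have hcent : (rootSpan x fun k l => (k = i ∧ l = j) ∨ (k = j ∧ l = i)) ≤
        Subgroup.centralizer {x p q a} := by
      refine rootSpan_le fun k l hkl hP b => ?_
      rw [Subgroup.mem_centralizer_singleton_iff]
      rcases hP with ⟨rfl, rfl⟩ | ⟨rfl, rfl⟩
      · exact (hx.commute hkl hpq (Ne.symm hpj) (Ne.symm hqi) b a).eq
      · exact (hx.commute hkl hpq (Ne.symm hpi) (Ne.symm hqj) b a).eq
    rw [Subgroup.mem_centralizer_singleton_iff.mp (hcent hg), mul_inv_cancel_right]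

theorem mem_rootTorus_of_actsAs_diagonal (hn : 3 ≤ n) (hij : i ≠ j) {g : S}
    (hg : g ∈ rootSpan x fun k l => (k = i ∧ l = j) ∨ (k = j ∧ l = i))
    {M : (Matrix (Fin 2) (Fin 2) A)ˣ} (hM : ActsAs x i j g M)
    (h01 : M.1 0 1 = 0) (h10 : M.1 1 0 = 0) : g ∈ rootTorus x := by
  have e : ∀ r s, M.1 r 0 * M⁻¹.1 0 s + M.1 r 1 * M⁻¹.1 1 s =
      (1 : Matrix (Fin 2) (Fin 2) A) r s := by
    intro r s
    have := congrFun (congrFun M.mul_inv r) s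
    rwa [Matrix.mul_apply, Fin.sum_univ_two] at this
  have e' : ∀ r s, M⁻¹.1 r 0 * M.1 0 s + M⁻¹.1 r 1 * M.1 1 s =
      (1 : Matrix (Fin 2) (Fin 2) A) r s := by
    intro r s
    have := congrFun (congrFun M.inv_mul r) s
    rwa [Matrix.mul_apply, Fin.sum_univ_two] at this
  have h01' : M⁻¹.1 0 1 = 0 := by
    have h1 : M⁻¹.1 0 1 * M.1 1 1 = 0 := by simpa [h01] using e' 0 1
    have h2 : M.1 1 1 * M⁻¹.1 1 1 = 1 := by simpa [h10] using e 1 1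
    rw [← mul_one (M⁻¹.1 0 1), ← h2, ← mul_assoc, h1, zero_mul]
  have h10' : M⁻¹.1 1 0 = 0 := by
    have h1 : M⁻¹.1 1 0 * M.1 0 0 = 0 := by simpa [h10] using e' 1 0
    have h2 : M.1 0 0 * M⁻¹.1 0 0 = 1 := by simpa [h01] using e 0 0
    rw [← mul_one (M⁻¹.1 1 0), ← h2, ← mul_assoc, h1, zero_mul]
  intro p q hpq a
  refine ⟨hx.conj_root_of_actsAs_diagonal hn hij hg hM h01 h10 h01' h10' hpq a, ?_⟩
  have := hx.conj_root_of_actsAs_diagonal hn hij (inv_mem hg) hM.inv h01' h10'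
    (by simpa using h01) (by simpa using h10) hpq a
  simpa using this

/-- The Gauss decomposition of a rank one subgroup. Stable range one makes the upper left entry of
the acting matrix invertible after a row operation; row and column operations then diagonalize
it, and what remains lies in the torus. -/
theorem rank_one_decomposition [Finite A] (hn : 3 ≤ n) (hij : i ≠ j) {g : S}
    (hg : g ∈ rootSpan x fun k l => (k = i ∧ l = j) ∨ (k = j ∧ l = i)) :
    ∃ a b c, ∃ t ∈ rootTorus x, g = x i j a * x j i b * x i j c * t := by
  obtain ⟨M, hM⟩ := hx.exists_actsAs hij hg
  have hleft : M⁻¹.1 0 0 * M.1 0 0 + M⁻¹.1 0 1 * M.1 1 0 = 1 := by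
    have := congrFun (congrFun M.inv_mul 0) 0
    rwa [Matrix.mul_apply, Fin.sum_univ_two] at this
  obtain ⟨r, e, he⟩ := exists_isUnit_add_mul hleft
  set s : A := -(M.1 1 0 * ↑e⁻¹)
  set w : A := -(↑e⁻¹ * (M.1 0 1 + r * M.1 1 1))
  have hup : ∀ a, x i j a ∈ rootSpan x fun k l => (k = i ∧ l = j) ∨ (k = j ∧ l = i) :=
    mem_rootSpan hij (Or.inl ⟨rfl, rfl⟩)
  have hlow : ∀ a, x j i a ∈ rootSpan x fun k l => (k = i ∧ l = j) ∨ (k = j ∧ l = i) :=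
    mem_rootSpan hij.symm (Or.inr ⟨rfl, rfl⟩)
  set t : S := x j i s * x i j r * g * x i j w
  have htM : ActsAs x i j t (lowerUnit s * upperUnit r * M * upperUnit w) :=
    (((hx.actsAs_lower hij s).mul (hx.actsAs_upper hij r)).mul hM).mul (hx.actsAs_upper hij w)
  have hval : (upperUnit r).1 * M.1 =
      !![(e : A), M.1 0 1 + r * M.1 1 1; M.1 1 0, M.1 1 1] := by
    rw [he]
    ext p q
    fin_cases p <;> fin_cases q <;> simp [upperUnit, Matrix.mul_apply, Fin.sum_univ_two]
  have ht : t ∈ rootTorus x := by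
    refine hx.mem_rootTorus_of_actsAs_diagonal hn hij
      (mul_mem (mul_mem (mul_mem (hlow s) (hup r)) hg) (hup w)) htM ?_ ?_
    · rw [Units.val_mul, Units.val_mul, Units.val_mul, mul_assoc (lowerUnit s).1, hval]
      simp [lowerUnit, upperUnit, w]
    · rw [Units.val_mul, Units.val_mul, Units.val_mul, mul_assoc (lowerUnit s).1, hval]
      simp [lowerUnit, upperUnit, s]
  obtain ⟨c, hc⟩ := (ht i j hij (-w)).1
  refine ⟨-r, -s, c, t, ht, ?_⟩
  rw [← hc, hx.map_neg hij, hx.map_neg hij, hx.map_neg hij.symm]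
  simp only [t]
  group

end IsSteinbergFamily

end PairAction

/-! ### Groups generated by a Steinberg family over a finite ring are finite -/

open scoped commutatorElement in
/-- A group whose center has finite index has finitely many commutators, hence by Schur's theorem
a finite commutator subgroup; a perfect such group is finite. -/
theorem finite_of_perfect_of_finite_range_conj {S : Type*} [Group S]
    (hS : ∀ g : S, g ∈ _root_.commutator S) (h : (Set.range (MulAut.conj : S →* MulAut S)).Finite) :
    Finite S := by
  have hfin := h.to_subtype
  have hcomm : ∀ g h g' h' : S, MulAut.conj g = MulAut.conj g' → MulAut.conj h = MulAut.conj h' →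
      ⁅g, h⁆ = ⁅g', h'⁆ := by
    intro g h g' h' e₁ e₂
    have h1 : g * h * g⁻¹ = g' * h * g'⁻¹ := DFunLike.congr_fun e₁ h
    have h2 : h * g'⁻¹ * h⁻¹ = h' * g'⁻¹ * h'⁻¹ := DFunLike.congr_fun e₂ g'⁻¹
    calc ⁅g, h⁆ = (g * h * g⁻¹) * h⁻¹ := rfl
      _ = g' * (h * g'⁻¹ * h⁻¹) := by rw [h1]; group
      _ = ⁅g', h'⁆ := by rw [h2, commutatorElement_def]; group
  have hset : Finite (commutatorSet S) := by
    let F : Set.range (MulAut.conj : S →* MulAut S) × Set.range (MulAut.conj : S →* MulAut S) → S :=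
      fun p => ⁅p.1.2.choose, p.2.2.choose⁆
    refine ((Set.finite_range F).subset ?_).to_subtype
    rintro _ ⟨g, h, rfl⟩
    refine ⟨(⟨_, g, rfl⟩, ⟨_, h, rfl⟩), hcomm _ _ _ _ ?_ ?_⟩
    · exact (⟨g, rfl⟩ : ∃ y, MulAut.conj y = MulAut.conj g).choose_spec
    · exact (⟨h, rfl⟩ : ∃ y, MulAut.conj y = MulAut.conj h).choose_spec
  have hfinc : Finite (_root_.commutator S) := inferInstance
  exact Finite.of_injective (fun g : S => (⟨g, hS g⟩ : _root_.commutator S))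
    fun a b hab => congrArg Subtype.val hab

namespace IsSteinbergFamily

variable {n : ℕ} {A S : Type*} [Ring A] [Group S] {x : Fin n → Fin n → A → S}
  (hx : IsSteinbergFamily x)

include hx

theorem rootSpan_adjacent_eq_top (hgen : rootSpan x (fun _ _ => True) = ⊤) :
    rootSpan x (fun k l => k.val + 1 = l ∨ l.val + 1 = k) = ⊤ := by
  set N := rootSpan x (fun k l => k.val + 1 = l ∨ l.val + 1 = k)
  have key : ∀ (d : ℕ) (i j : Fin n), i.val + d + 1 = j → ∀ a, x i j a ∈ N ∧ x j i a ∈ N := by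
    intro d
    induction d with
    | zero =>
      intro i j h a
      have hij : i ≠ j := fun e => by subst e; omega
      exact ⟨mem_rootSpan hij (Or.inl h) a, mem_rootSpan hij.symm (Or.inr h) a⟩
    | succ d ih =>
      intro i j h a
      let k : Fin n := ⟨i.val + d + 1, by have := j.2; omega⟩
      have hij : i ≠ j := fun e => by subst e; omega
      have hik : i ≠ k := fun e => by have := congrArg Fin.val e; simp only [k] at this; omega
      have hkj : k ≠ j := fun e => by have := congrArg Fin.val e; simp only [k] at this; omega
      have h1 := ih i k rfl
      have h2 : ∀ a, x k j a ∈ N ∧ x j k a ∈ N := fun a =>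
        have hP : k.val + 1 = j := by simp only [k]; omega
        ⟨mem_rootSpan hkj (Or.inl hP) a, mem_rootSpan hkj.symm (Or.inr hP) a⟩
      constructor
      · rw [← mul_one a, hx.commutator hik hkj hij]
        exact mul_mem (mul_mem (mul_mem (h1 a).1 (h2 1).1) (inv_mem (h1 a).1)) (inv_mem (h2 1).1)
      · rw [← mul_one a, hx.commutator hkj.symm hik.symm hij.symm]
        exact mul_mem (mul_mem (mul_mem (h2 a).2 (h1 1).2) (inv_mem (h2 a).2)) (inv_mem (h1 1).2)
  rw [eq_top_iff, ← hgen]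
  refine rootSpan_le fun i j hij _ a => ?_
  rcases lt_or_gt_of_ne (Fin.val_ne_of_ne hij) with h | h
  · exact (key (j.val - i.val - 1) i j (by omega) a).1
  · exact (key (i.val - j.val - 1) j i (by omega) a).2

theorem exists_eq_root_mul {P Q : Fin n → Fin n → Prop} {i j : Fin n} (hij : i ≠ j)
    (hPQ : ∀ k l, P k l → (k = i ∧ l = j) ∨ Q k l)
    (hnorm : rootSpan x (fun k l => k = i ∧ l = j) ≤ Subgroup.normalizer (rootSpan x Q : Set S))
    {g : S} (hg : g ∈ rootSpan x P) : ∃ a, ∃ v ∈ rootSpan x Q, g = x i j a * v := by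
  have hle : rootSpan x P ≤ rootSpan x (fun k l => k = i ∧ l = j) ⊔ rootSpan x Q := by
    refine rootSpan_le fun k l hkl hP a => ?_
    rcases hPQ k l hP with h | h
    · exact Subgroup.mem_sup_left (mem_rootSpan hkl h a)
    · exact Subgroup.mem_sup_right (mem_rootSpan hkl h a)
  have h1 := hle hg
  rw [← SetLike.mem_coe, Subgroup.coe_mul_of_left_le_normalizer_right _ _ hnorm] at h1
  obtain ⟨y, hy, v, hv, rfl⟩ := h1
  obtain ⟨a, rfl⟩ := hx.exists_eq_of_mem_rootSpan_singleton hij hy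
  exact ⟨a, v, hv, rfl⟩

/-- The set `U L U T` is stable under left multiplication by the rank one subgroup of a simple root
`(i, i + 1)`: that subgroup normalizes the spans of the other positive roots and of the other
negative roots, so that the rank one decomposition can be inserted. -/
theorem rank_one_mul_decomposition [Finite A] (hn : 3 ≤ n) {i j : Fin n} (hij' : i.val + 1 = j)
    {s u l u' t : S} (hs : s ∈ rootSpan x fun k l => (k = i ∧ l = j) ∨ (k = j ∧ l = i))
    (hu : u ∈ rootSpan x (· < ·)) (hl : l ∈ rootSpan x (· > ·)) (hu' : u' ∈ rootSpan x (· < ·))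
    (ht : t ∈ rootTorus x) :
    ∃ v ∈ rootSpan x (· < ·), ∃ m ∈ rootSpan x (· > ·), ∃ v' ∈ rootSpan x (· < ·),
      ∃ t' ∈ rootTorus x, s * (u * l * u' * t) = v * m * v' * t' := by
  have hij : i ≠ j := fun e => by subst e; omega
  have hlt : i < j := by rw [Fin.lt_def]; omega
  let Rα : Subgroup S := rootSpan x fun k l => (k = i ∧ l = j) ∨ (k = j ∧ l = i)
  let Uα : Subgroup S := rootSpan x fun k l => k < l ∧ ¬(k = i ∧ l = j)
  let Lα : Subgroup S := rootSpan x fun k l => k > l ∧ ¬(k = j ∧ l = i)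
  have hRU : Rα ≤ Subgroup.normalizer (Uα : Set S) := by
    refine hx.rootSpan_le_normalizer fun k l p q hkl hpq hP hQ => ?_
    simp only [Fin.lt_def, Fin.ext_iff, ne_eq] at *
    omega
  have hRL : Rα ≤ Subgroup.normalizer (Lα : Set S) := by
    refine hx.rootSpan_le_normalizer fun k l p q hkl hpq hP hQ => ?_
    simp only [Fin.lt_def, Fin.ext_iff, ne_eq, gt_iff_lt] at *
    omega
  have hUle : Uα ≤ rootSpan x (· < ·) := rootSpan_mono fun _ _ h => h.1
  have hLle : Lα ≤ rootSpan x (· > ·) := rootSpan_mono fun _ _ h => h.1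
  have hup : ∀ a, x i j a ∈ Rα := mem_rootSpan hij (Or.inl ⟨rfl, rfl⟩)
  have hlow : ∀ a, x j i a ∈ Rα := mem_rootSpan hij.symm (Or.inr ⟨rfl, rfl⟩)
  obtain ⟨a, v, hv, rfl⟩ := hx.exists_eq_root_mul (Q := fun k l => k < l ∧ ¬(k = i ∧ l = j)) hij
    (fun k l h => by tauto) ((rootSpan_mono fun k l h => Or.inl h).trans hRU) hu
  obtain ⟨b, m, hm, rfl⟩ := hx.exists_eq_root_mul (Q := fun k l => k > l ∧ ¬(k = j ∧ l = i))
    hij.symm (fun k l h => by tauto) ((rootSpan_mono fun k l h => Or.inr h).trans hRL) hl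
  have hr : s * x i j a ∈ Rα := mul_mem hs (hup a)
  obtain ⟨a₁, b₁, c₁, t₀, ht₀, he⟩ := hx.rank_one_decomposition hn hij (mul_mem hr (hlow b))
  have hv' := (Subgroup.mem_normalizer_iff.mp (hRU hr) v).mp hv
  have hm' := (Subgroup.mem_normalizer_iff.mp (rootTorus_le_normalizer x _ ht₀) m).mp hm
  have hm'' := (Subgroup.mem_normalizer_iff.mp (hRL (hup c₁)) _).mp hm'
  have hu'' := (Subgroup.mem_normalizer_iff.mp (rootTorus_le_normalizer x _ ht₀) u').mp hu'
  refine ⟨_, mul_mem (hUle hv') (mem_rootSpan hij hlt a₁),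
    _, mul_mem (mem_rootSpan hij.symm hlt b₁) (hLle hm''),
    _, mul_mem (mem_rootSpan hij hlt c₁) hu'', _, mul_mem ht₀ ht, ?_⟩
  calc s * (x i j a * v * (x j i b * m) * u' * t)
      = s * x i j a * v * (s * x i j a)⁻¹ * (s * x i j a * x j i b) * m * u' * t := by group
    _ = _ := by rw [he]; group

/-- Gauss decomposition `S = U L U T`. -/
theorem exists_decomposition [Finite A] (hn : 3 ≤ n)
    (hgen : rootSpan x (fun _ _ => True) = ⊤) (g : S) :
    ∃ u ∈ rootSpan x (· < ·), ∃ l ∈ rootSpan x (· > ·), ∃ u' ∈ rootSpan x (· < ·),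
      ∃ t ∈ rootTorus x, g = u * l * u' * t := by
  have hg : g ∈ rootSpan x (fun k l => k.val + 1 = l ∨ l.val + 1 = k) := by
    rw [hx.rootSpan_adjacent_eq_top hgen]; trivial
  have hpair : ∀ y ∈ {g : S | ∃ (i j : Fin n) (a : A), i ≠ j ∧
      (i.val + 1 = j ∨ j.val + 1 = i) ∧ g = x i j a},
      ∃ i j : Fin n, i.val + 1 = j ∧
        y ∈ rootSpan x fun k l => (k = i ∧ l = j) ∨ (k = j ∧ l = i) := by
    rintro _ ⟨i, j, a, hij, h | h, rfl⟩
    · exact ⟨i, j, h, mem_rootSpan hij (Or.inl ⟨rfl, rfl⟩) a⟩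
    · exact ⟨j, i, h, mem_rootSpan hij (Or.inr ⟨rfl, rfl⟩) a⟩
  induction hg using Subgroup.closure_induction_left with
  | one => exact ⟨1, one_mem _, 1, one_mem _, 1, one_mem _, 1, one_mem _, by simp⟩
  | mul_left y hy z _ ih =>
    obtain ⟨u, hu, l, hl, u', hu', t, ht, rfl⟩ := ih
    obtain ⟨i, j, hij, hmem⟩ := hpair y hy
    exact hx.rank_one_mul_decomposition hn hij hmem hu hl hu' ht
  | inv_mul_cancel y hy z _ ih =>
    obtain ⟨u, hu, l, hl, u', hu', t, ht, rfl⟩ := ih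
    obtain ⟨i, j, hij, hmem⟩ := hpair y hy
    exact hx.rank_one_mul_decomposition hn hij (inv_mem hmem) hu hl hu' ht

theorem mem_commutator (hn : 3 ≤ n) (hgen : rootSpan x (fun _ _ => True) = ⊤) (g : S) :
    g ∈ _root_.commutator S := by
  have : (⊤ : Subgroup S) ≤ _root_.commutator S := by
    rw [← hgen]
    refine rootSpan_le fun i j hij _ a => ?_
    obtain ⟨k, hk⟩ := Fin.exists_ne_and_ne_of_three_le hn i j
    rw [← mul_one a, hx.commutator (Ne.symm hk.1) hk.2 hij]
    exact Subgroup.commutator_mem_commutator (Subgroup.mem_top _) (Subgroup.mem_top _)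
  exact this (Subgroup.mem_top g)

open scoped Pointwise in
/-- Since `S = U L U T` with `U` and `L` finite and `T` normalizing the finite root subgroups, every
root element has finitely many conjugates; so there are finitely many inner automorphisms, and
Schur's theorem applies to the perfect group `S`. -/
theorem finite [Finite A] (hn : 3 ≤ n) (hgen : rootSpan x (fun _ _ => True) = ⊤) : Finite S := by
  have hU : Finite (rootSpan x (· < ·)) := by
    have := hx.finite_rootSpan_of_order (fun k => n - k.val) fun a b h => by
      have := a.2; have := b.2; simp only at h; exact Fin.ext (by omega)
    refine Finite.of_injective _ (Subgroup.inclusion_injective (rootSpan_mono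
      (Q := fun k l => n - l.val < n - k.val) fun k l h => ?_))
    have := l.2
    rw [Fin.lt_def] at h
    omega
  have hL : Finite (rootSpan x (· > ·)) := hx.finite_rootSpan_of_order Fin.val Fin.val_injective
  let Y : Set S := (rootSpan x (· < ·) : Set S) * (rootSpan x (· > ·) : Set S) *
    (rootSpan x (· < ·) : Set S)
  have hY : Y.Finite := ((Set.toFinite _).mul (Set.toFinite _)).mul (Set.toFinite _)
  let I := {p : Fin n × Fin n // p.1 ≠ p.2} × A
  let y : I → S := fun p => x p.1.1.1 p.1.1.2 p.2
  have hconj : ∀ (g : S) (p : I), g * y p * g⁻¹ ∈ Set.image2 (fun h q => h * y q * h⁻¹) Y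
      Set.univ := by
    rintro g ⟨⟨⟨i, j⟩, hij⟩, a⟩
    obtain ⟨u, hu, l, hl, u', hu', t, ht, rfl⟩ := hx.exists_decomposition hn hgen g
    obtain ⟨b, hb⟩ := (ht i j hij a).1
    refine ⟨u * l * u', Set.mul_mem_mul (Set.mul_mem_mul hu hl) hu', (⟨(i, j), hij⟩, b),
      trivial, ?_⟩
    simp only [y]
    rw [← hb]
    group
  let Z := Set.image2 (fun h q => h * y q * h⁻¹) Y (Set.univ : Set I)
  have hZ : Finite Z := (hY.image2 _ Set.finite_univ).to_subtype
  refine finite_of_perfect_of_finite_range_conj (hx.mem_commutator hn hgen) ?_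
  have hfin : Finite (Set.range (MulAut.conj : S →* MulAut S)) := by
    refine Finite.of_injective (β := I → Z)
      (fun φ p => ⟨φ.1 (y p), by obtain ⟨g, hg⟩ := φ.2; rw [← hg]; exact hconj g p⟩) ?_
    intro φ ψ h
    refine Subtype.ext (MulEquiv.toMonoidHom_injective
      (MonoidHom.eq_of_eqOn_dense hgen ?_))
    rintro _ ⟨i, j, a, hij, -, rfl⟩
    exact congrArg Subtype.val (congrFun h (⟨(i, j), hij⟩, a))
  exact Set.toFinite _

end IsSteinbergFamily

/-! ### The elementary group -/

section Elementary

variable {n : ℕ} {R : Type*} [Ring R]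

/-- The elementary matrix `e_{ij}(r)` as an element of `E_n(R)`, with the value `1` if `i = j`. -/
def elementaryRoot (n : ℕ) (R : Type*) [Ring R] (i j : Fin n) (r : R) : elementaryGroup n R :=
  if h : i ≠ j then ⟨elementaryMatrix i j h r, Subgroup.subset_closure ⟨i, j, h, r, rfl⟩⟩ else 1

theorem coe_elementaryRoot {i j : Fin n} (h : i ≠ j) (r : R) :
    (elementaryRoot n R i j r : Matrix.GeneralLinearGroup (Fin n) R).1 =
      1 + Matrix.single i j r := by
  rw [elementaryRoot, dif_pos h]
  rfl

theorem isSteinbergFamily_elementaryRoot : IsSteinbergFamily (elementaryRoot n R) where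
  map_add := by
    intro i j hij a b
    refine Subtype.ext (Units.ext ?_)
    rw [Subgroup.coe_mul, Units.val_mul, coe_elementaryRoot hij, coe_elementaryRoot hij,
      coe_elementaryRoot hij, mul_add, add_mul, add_mul,
      Matrix.single_mul_single_of_ne _ _ _ _ hij.symm, Matrix.single_add]
    simp [add_assoc]
  commute := by
    intro i j k l hij hkl hjk hil a b
    refine Subtype.ext (Units.ext ?_)
    rw [Subgroup.coe_mul, Units.val_mul, Subgroup.coe_mul, Units.val_mul, coe_elementaryRoot hij,
      coe_elementaryRoot hkl, mul_add, add_mul, add_mul,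
      Matrix.single_mul_single_of_ne _ _ _ _ hjk, mul_add, add_mul, add_mul,
      Matrix.single_mul_single_of_ne _ _ _ _ hil.symm]
    simp only [mul_one, one_mul, add_zero]
    abel
  mul_comm_mul := by
    intro i j k hij hjk hik a b
    refine Subtype.ext (Units.ext ?_)
    simp only [Subgroup.coe_mul, Units.val_mul, coe_elementaryRoot hij, coe_elementaryRoot hjk,
      coe_elementaryRoot hik, mul_add, add_mul, mul_one, one_mul,
      Matrix.single_mul_single_same,
      Matrix.single_mul_single_of_ne _ _ _ _ hjk.symm,
      Matrix.single_mul_single_of_ne _ _ _ _ hik.symm, add_zero]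
    abel

theorem rootSpan_elementaryRoot_eq_top :
    rootSpan (elementaryRoot n R) (fun _ _ => True) = ⊤ := by
  have hle : elementaryGroup n R ≤
      (rootSpan (elementaryRoot n R) (fun _ _ => True)).map (elementaryGroup n R).subtype := by
    refine (Subgroup.closure_le _).mpr ?_
    rintro _ ⟨i, j, hij, r, rfl⟩
    refine ⟨elementaryRoot n R i j r, mem_rootSpan hij trivial r, ?_⟩
    rw [elementaryRoot, dif_pos hij]
    rfl
  rw [eq_top_iff]
  rintro g -
  obtain ⟨h, hh, he⟩ := hle g.2
  rwa [← Subtype.ext he]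

/-- `E_n(R)` is generated by the `e_{ij}(r)` with `r = 1` or `r` in a finite generating set of the
ring: the `r` such that all `e_{ij}(r)` lie in a given subgroup are closed under addition, and
by the commutator relation under multiplication. -/
theorem elementaryGroup_fg (hR : Algebra.FiniteType ℤ R) (hn : 3 ≤ n) :
    Group.FG (elementaryGroup n R) := by
  have hx := isSteinbergFamily_elementaryRoot (n := n) (R := R)
  obtain ⟨F, hF⟩ := hR.out
  let gens : Set (elementaryGroup n R) :=
    (fun p : (Fin n × Fin n) × R => elementaryRoot n R p.1.1 p.1.2 p.2) ''
      (Set.univ ×ˢ (insert 1 (F : Set R)))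
  have hgens : gens.Finite :=
    (Set.finite_univ.prod (F.finite_toSet.insert 1)).image _
  let N := Subgroup.closure gens
  have hN : ∀ i j, i ≠ j → ∀ r ∈ insert 1 (F : Set R), elementaryRoot n R i j r ∈ N :=
    fun i j _ r hr => Subgroup.subset_closure ⟨((i, j), r), ⟨trivial, hr⟩, rfl⟩
  let B : Subring R :=
    { carrier := {r | ∀ i j, i ≠ j → elementaryRoot n R i j r ∈ N}
      one_mem' := fun i j hij => hN i j hij 1 (Set.mem_insert _ _)
      zero_mem' := fun i j hij => by rw [hx.map_zero hij]; exact one_mem _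
      add_mem' := fun ha hb i j hij => by
        rw [hx.map_add hij]; exact mul_mem (ha i j hij) (hb i j hij)
      neg_mem' := fun ha i j hij => by rw [hx.map_neg hij]; exact inv_mem (ha i j hij)
      mul_mem' := fun ha hb i j hij => by
        obtain ⟨k, hki, hkj⟩ := Fin.exists_ne_and_ne_of_three_le hn i j
        rw [hx.commutator (Ne.symm hki) hkj hij]
        exact mul_mem (mul_mem (mul_mem (ha i k hki.symm) (hb k j hkj))
          (inv_mem (ha i k hki.symm))) (inv_mem (hb k j hkj)) }
  have hB : ∀ r : R, r ∈ B := by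
    intro r
    have h1 : Algebra.adjoin ℤ (F : Set R) ≤ subalgebraOfSubring B :=
      Algebra.adjoin_le fun r hr i j hij => hN i j hij r (Set.mem_insert_of_mem _ hr)
    rw [hF] at h1
    exact h1 (Algebra.mem_top (x := r))
  rw [Group.fg_iff]
  refine ⟨gens, ?_, hgens⟩
  rw [eq_top_iff, ← rootSpan_elementaryRoot_eq_top]
  exact rootSpan_le fun i j hij _ r => hB r i j hij

/-- The homomorphism `r ↦ e_{ij}(r)` from the additive group of `R`. -/
def elementaryRootHom {i j : Fin n} (hij : i ≠ j) : Multiplicative R →* elementaryGroup n R where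
  toFun r := elementaryRoot n R i j r.toAdd
  map_one' := isSteinbergFamily_elementaryRoot.map_zero hij
  map_mul' a b := isSteinbergFamily_elementaryRoot.map_add hij a.toAdd b.toAdd

/-- A normal subgroup `K` of `E_n(R)` meeting each root subgroup in a subgroup of finite index has
finite index. The `r` with all `e_{ij}(r)` in `K` form a two-sided ideal `I` of finite index, and
`E_n(R) / K` is generated by a Steinberg family over `R / I`. -/
theorem finite_quotient_of_finiteIndex_root (hn : 3 ≤ n) (K : Subgroup (elementaryGroup n R))
    [K.Normal] (hK : ∀ (i j : Fin n) (hij : i ≠ j),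
      (K.comap (elementaryRootHom (R := R) hij)).FiniteIndex) :
    Finite (elementaryGroup n R ⧸ K) := by
  have hx := isSteinbergFamily_elementaryRoot (n := n) (R := R)
  have hconj : ∀ {a : elementaryGroup n R}, a ∈ K → ∀ g, g * a * g⁻¹ ∈ K :=
    fun ha g => Subgroup.Normal.conj_mem inferInstance _ ha g
  let I : Ideal R :=
    { carrier := {r | ∀ i j, i ≠ j → elementaryRoot n R i j r ∈ K}
      zero_mem' := fun i j hij => by rw [hx.map_zero hij]; exact one_mem _
      add_mem' := fun ha hb i j hij => by
        rw [hx.map_add hij]; exact mul_mem (ha i j hij) (hb i j hij)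
      smul_mem' := fun s r hr i j hij => by
        obtain ⟨k, hki, hkj⟩ := Fin.exists_ne_and_ne_of_three_le hn i j
        rw [smul_eq_mul, hx.commutator (Ne.symm hki) hkj hij]
        exact mul_mem (hconj (hr k j hkj) _) (inv_mem (hr k j hkj)) }
  have hI : I.IsTwoSided := ⟨fun {r} s hr i j hij => by
    obtain ⟨k, hki, hkj⟩ := Fin.exists_ne_and_ne_of_three_le hn i j
    rw [hx.commutator (Ne.symm hki) hkj hij, mul_assoc, mul_assoc,
      ← mul_assoc (elementaryRoot n R k j s)]
    exact mul_mem (hr i k hki.symm) (hconj (inv_mem (hr i k hki.symm)) _)⟩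
  have hfin : Finite (R ⧸ I) := by
    let H : Subgroup (Multiplicative R) :=
      ⨅ p : {p : Fin n × Fin n // p.1 ≠ p.2}, K.comap (elementaryRootHom (R := R) p.2)
    have hH : H.FiniteIndex := Subgroup.finiteIndex_iInf fun p => hK _ _ p.2
    have : Finite (Multiplicative R ⧸ H) := inferInstance
    refine Finite.of_surjective (α := Multiplicative R ⧸ H)
      (Quotient.lift (fun r => Ideal.Quotient.mk I (Multiplicative.toAdd r)) ?_) ?_
    · intro a b hab
      have hab' : a⁻¹ * b ∈ H := QuotientGroup.leftRel_apply.mp hab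
      refine (Ideal.Quotient.eq.mpr ?_).symm
      intro i j hij
      have h1 := Subgroup.mem_iInf.mp hab' ⟨(i, j), hij⟩
      have h2 : (a⁻¹ * b).toAdd = b.toAdd - a.toAdd := by
        rw [toAdd_mul, toAdd_inv]; abel
      rw [← h2]
      exact h1
    · intro q
      obtain ⟨r, rfl⟩ := Ideal.Quotient.mk_surjective q
      exact ⟨QuotientGroup.mk (Multiplicative.ofAdd r), rfl⟩
  let y : Fin n → Fin n → R ⧸ I → elementaryGroup n R ⧸ K :=
    fun i j q => QuotientGroup.mk (elementaryRoot n R i j (Quotient.out q))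
  have hy : ∀ {i j}, i ≠ j → ∀ r, y i j (Ideal.Quotient.mk I r) =
      QuotientGroup.mk (elementaryRoot n R i j r) := by
    intro i j hij r
    refine QuotientGroup.eq.mpr ?_
    rw [← hx.map_neg hij, ← hx.map_add hij]
    have h1 : Ideal.Quotient.mk I (Quotient.out (Ideal.Quotient.mk I r)) =
      Ideal.Quotient.mk I r := Quotient.out_eq _
    have h2 := Ideal.Quotient.eq.mp h1.symm
    rw [neg_add_eq_sub]
    exact h2 i j hij
  have hyS : IsSteinbergFamily y := by
    constructor
    · intro i j hij a b
      obtain ⟨a, rfl⟩ := Ideal.Quotient.mk_surjective a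
      obtain ⟨b, rfl⟩ := Ideal.Quotient.mk_surjective b
      rw [← map_add, hy hij, hy hij, hy hij, hx.map_add hij, QuotientGroup.mk_mul]
    · intro i j k l hij hkl hjk hil a b
      obtain ⟨a, rfl⟩ := Ideal.Quotient.mk_surjective a
      obtain ⟨b, rfl⟩ := Ideal.Quotient.mk_surjective b
      rw [hy hij, hy hkl]
      exact (hx.commute hij hkl hjk hil a b).map (QuotientGroup.mk' K)
    · intro i j k hij hjk hik a b
      obtain ⟨a, rfl⟩ := Ideal.Quotient.mk_surjective a
      obtain ⟨b, rfl⟩ := Ideal.Quotient.mk_surjective b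
      rw [← map_mul, hy hij, hy hjk, hy hik, ← QuotientGroup.mk_mul, hx.mul_comm_mul hij hjk hik,
        QuotientGroup.mk_mul, QuotientGroup.mk_mul]
  refine hyS.finite hn ?_
  rw [eq_top_iff, ← (QuotientGroup.mk' K).range_eq_top.mpr (QuotientGroup.mk'_surjective K),
    MonoidHom.range_eq_map, ← rootSpan_elementaryRoot_eq_top, Subgroup.map_le_iff_le_comap]
  refine rootSpan_le fun i j hij _ r => ?_
  rw [Subgroup.mem_comap, QuotientGroup.mk'_apply, ← hy hij]
  exact mem_rootSpan hij trivial _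

end Elementary

/-! ### Homomorphisms from finite-index subgroups of the elementary group -/

section KeyStep

theorem MonoidHom.finiteIndex_ker_of_finite_range {M Q : Type*} [Group M] [Group Q] (f : M →* Q)
    (h : (Set.range f).Finite) : f.ker.FiniteIndex := by
  have : Finite f.range := h.to_subtype
  exact ⟨by rw [Subgroup.index_ker]; exact Nat.card_pos.ne'⟩

theorem Subgroup.finiteIndex_comap {M N : Type*} [Group M] [Group N] (H : Subgroup N)
    [H.FiniteIndex] (f : M →* N) : (H.comap f).FiniteIndex :=
  ⟨by
    rw [Subgroup.index_comap]
    exact (Subgroup.instFiniteIndex_subgroupOf H f.range).index_ne_zero⟩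

theorem Subgroup.finiteIndex_of_finiteIndex_subgroupOf {M : Type*} [Group M] {K D : Subgroup M}
    (hKD : K ≤ D) (hD : D.FiniteIndex) (hK : (K.subgroupOf D).FiniteIndex) : K.FiniteIndex :=
  ⟨by
    rw [← Subgroup.relIndex_mul_index hKD]
    exact mul_ne_zero hK.index_ne_zero hD.index_ne_zero⟩

/-- A torsion abelian subgroup that is finitely generated is finite. -/
theorem Subgroup.finite_of_fg_of_comm_of_torsion {Q : Type*} [Group Q] (B : Subgroup Q)
    (hfg : B.FG) (hcomm : ∀ a ∈ B, ∀ b ∈ B, a * b = b * a) (htor : ∀ a ∈ B, IsOfFinOrder a) :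
    Finite B := by
  let _ : CommGroup B :=
    { (inferInstance : Group B) with
      mul_comm := fun a b => Subtype.ext (hcomm a a.2 b b.2) }
  have : Group.FG B := (Group.fg_iff_subgroup_fg B).mpr hfg
  exact CommGroup.finite_of_fg_isMulTorsion B fun a =>
    Submonoid.isOfFinOrder_coe.mp (htor a a.2)

theorem IsSteinbergFamily.map_nsmul {n : ℕ} {A S : Type*} [Ring A] [Group S]
    {x : Fin n → Fin n → A → S} (hx : IsSteinbergFamily x) {i j : Fin n} (hij : i ≠ j) (a : A)
    (m : ℕ) : x i j (m • a) = x i j a ^ m := by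
  induction m with
  | zero => rw [zero_smul, pow_zero, hx.map_zero hij]
  | succ m ih => rw [succ_nsmul, hx.map_add hij, ih, pow_succ]

variable {n : ℕ} {R : Type*} [Ring R] {Q : Type*} [Group Q]

/-- Conjugates of elementary matrices lying in `Γ` have images of finite order. A suitable power of
such an element is a commutator of two elements of `Γ` with which it commutes, so its length
vanishes. -/
theorem isOfFinOrder_map_conj_elementaryRoot (hn : 3 ≤ n) (Γ : Subgroup (elementaryGroup n R))
    [Γ.FiniteIndex] (φ : Γ →* Q) (hpos : HasPurelyPositiveLength φ.range) {i j : Fin n}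
    (hij : i ≠ j) (g : elementaryGroup n R) (r : R)
    (hmem : g * elementaryRoot n R i j r * g⁻¹ ∈ Γ) : IsOfFinOrder (φ ⟨_, hmem⟩) := by
  have hx := isSteinbergFamily_elementaryRoot (n := n) (R := R)
  obtain ⟨l, hl, hl'⟩ := hpos
  obtain ⟨k, hki, hkj⟩ := Fin.exists_ne_and_ne_of_three_le hn i j
  obtain ⟨a, ha, -, ha'⟩ := Subgroup.exists_pow_mem_of_index_ne_zero
    (Subgroup.FiniteIndex.index_ne_zero (H := Γ)) (g * elementaryRoot n R i k r * g⁻¹)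
  obtain ⟨b, hb, -, hb'⟩ := Subgroup.exists_pow_mem_of_index_ne_zero
    (Subgroup.FiniteIndex.index_ne_zero (H := Γ)) (g * elementaryRoot n R k j 1 * g⁻¹)
  have hz' : (g * elementaryRoot n R i j r * g⁻¹) ^ (a * b) =
      g * elementaryRoot n R i j ((a • r) * (b • 1)) * g⁻¹ := by
    rw [smul_mul_smul_comm, mul_one, hx.map_nsmul hij, conj_pow]
  rw [conj_pow, ← hx.map_nsmul (Ne.symm hki)] at ha'
  rw [conj_pow, ← hx.map_nsmul hkj] at hb'
  let x' : Γ := ⟨_, ha'⟩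
  let y' : Γ := ⟨_, hb'⟩
  let z' : Γ := ⟨_, hmem⟩
  have hcoe : ((z' ^ (a * b) : Γ) : elementaryGroup n R) =
      g * elementaryRoot n R i j ((a • r) * (b • 1)) * g⁻¹ := hz'
  have h1 : x' * y' = z' ^ (a * b) * y' * x' := by
    refine Subtype.ext ?_
    rw [Subgroup.coe_mul, Subgroup.coe_mul, Subgroup.coe_mul, hcoe]
    have := hx.mul_comm_mul (Ne.symm hki) hkj hij (a • r) (b • 1)
    calc _ = g * (elementaryRoot n R i k (a • r) * elementaryRoot n R k j (b • 1)) * g⁻¹ := by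
          simp only [x', y']; group
      _ = _ := by rw [this]; simp only [x', y']; group
  have hc : ∀ {u v : elementaryGroup n R}, Commute u v → Commute (g * u * g⁻¹) (g * v * g⁻¹) :=
    fun h => h.map (MulAut.conj g)
  have h2 : Commute (z' ^ (a * b)) x' := by
    refine Subtype.ext ?_
    rw [Subgroup.coe_mul, Subgroup.coe_mul, hcoe]
    exact hc (hx.commute hij (Ne.symm hki) hij.symm (Ne.symm hki) _ _)
  have h3 : Commute (z' ^ (a * b)) y' := by
    refine Subtype.ext ?_
    rw [Subgroup.coe_mul, Subgroup.coe_mul, hcoe]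
    exact hc (hx.commute hij hkj (Ne.symm hkj) hij _ _)
  have h4 := congrArg φ.rangeRestrict h1
  rw [map_mul, map_mul, map_mul] at h4
  have h5 := hl.commutator_eq_zero h4 (h2.map φ.rangeRestrict) (h3.map φ.rangeRestrict)
  have h6 : IsOfFinOrder (φ.rangeRestrict (z' ^ (a * b))) := by
    by_contra hcon
    exact (hl' _ hcon).ne' h5
  rw [map_pow] at h6
  have h7 : IsOfFinOrder (φ.rangeRestrict z') := h6.of_pow (mul_ne_zero ha.ne' hb.ne')
  exact Submonoid.isOfFinOrder_coe.mpr h7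

/-- **One-step rigidity.** If every finitely generated subgroup of `Q` has a purely positive length
function and only finitely generated torsion abelian subgroups, then homomorphisms to `Q` from a
finite-index subgroup `Γ` of `E_n(R)` have finite image: their kernel contains finite-index
subgroups of all conjugates of root subgroups, hence so does its normal core. -/
theorem finite_range_of_purelyPositive (hR : Algebra.FiniteType ℤ R) (hn : 3 ≤ n)
    (Γ : Subgroup (elementaryGroup n R)) [hΓ : Γ.FiniteIndex] (φ : Γ →* Q)
    (hpos : ∀ P : Subgroup Q, P.FG → HasPurelyPositiveLength P)
    (htors : ∀ P : Subgroup Q, P.FG → ∀ B : Subgroup Q, B ≤ P →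
      (∀ a ∈ B, ∀ b ∈ B, a * b = b * a) → (∀ a ∈ B, IsOfFinOrder a) → B.FG) :
    (Set.range φ).Finite := by
  have := elementaryGroup_fg hR hn
  have hfg : φ.range.FG := (Group.fg_iff_subgroup_fg _).mp (Group.fg_range φ)
  let K : Subgroup (elementaryGroup n R) := φ.ker.map Γ.subtype
  have hKmem : ∀ {y} (hy : y ∈ Γ), y ∈ K ↔ φ ⟨y, hy⟩ = 1 := by
    intro y hy
    constructor
    · rintro ⟨z, hz, rfl⟩
      exact hz
    · intro h
      exact ⟨⟨y, hy⟩, h, rfl⟩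
  have hKΓ : K ≤ Γ := by
    rintro _ ⟨z, -, rfl⟩
    exact z.2
  have hconj : ∀ (g : elementaryGroup n R) (i j : Fin n) (hij : i ≠ j),
      (K.comap ((MulAut.conj g).toMonoidHom.comp (elementaryRootHom (R := R) hij))).FiniteIndex := by
    intro g i j hij
    let ψ : Multiplicative R →* elementaryGroup n R :=
      (MulAut.conj g).toMonoidHom.comp (elementaryRootHom (R := R) hij)
    let D : Subgroup (Multiplicative R) := Γ.comap ψ
    have hD : D.FiniteIndex := Γ.finiteIndex_comap ψ
    let χ : D →* Q := φ.comp (ψ.subgroupComap Γ)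
    have hχ : χ.ker = (K.comap ψ).subgroupOf D := by
      ext d
      exact (hKmem d.2).symm
    have htor : ∀ q ∈ χ.range, IsOfFinOrder q := by
      rintro _ ⟨d, rfl⟩
      exact isOfFinOrder_map_conj_elementaryRoot hn Γ φ (hpos _ hfg) hij g d.1.toAdd d.2
    have hcomm : ∀ a ∈ χ.range, ∀ b ∈ χ.range, a * b = b * a := by
      rintro _ ⟨c, rfl⟩ _ ⟨d, rfl⟩
      rw [← map_mul, mul_comm, map_mul]
    have hle : χ.range ≤ φ.range := by
      rintro _ ⟨d, rfl⟩
      exact ⟨_, rfl⟩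
    have hfin := Subgroup.finite_of_fg_of_comm_of_torsion _ (htors _ hfg _ hle hcomm htor)
      hcomm htor
    have hker := χ.finiteIndex_ker_of_finite_range (Set.toFinite (χ.range : Set Q))
    rw [hχ] at hker
    exact Subgroup.finiteIndex_of_finiteIndex_subgroupOf (Subgroup.comap_mono hKΓ) hD hker
  have hcore : ∀ (i j : Fin n) (hij : i ≠ j),
      (K.normalCore.comap (elementaryRootHom (R := R) hij)).FiniteIndex := by
    intro i j hij
    -- `K` is normalized by `Γ`, so only finitely many of its conjugates are distinct.
    let H : Subgroup (Multiplicative R) := ⨅ q : elementaryGroup n R ⧸ Γ,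
      K.comap ((MulAut.conj (Quotient.out q)⁻¹).toMonoidHom.comp (elementaryRootHom (R := R) hij))
    have hH : H.FiniteIndex := Subgroup.finiteIndex_iInf fun q => hconj _ i j hij
    refine Subgroup.finiteIndex_of_le (H := H) fun r hr g => ?_
    set y := elementaryRootHom (R := R) hij r
    obtain ⟨γ, hγ⟩ := QuotientGroup.mk_out_eq_mul Γ g⁻¹
    set o := Quotient.out (QuotientGroup.mk g⁻¹ : elementaryGroup n R ⧸ Γ)
    have h1 : o⁻¹ * y * o⁻¹⁻¹ ∈ K := Subgroup.mem_iInf.mp hr (QuotientGroup.mk g⁻¹)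
    have h2 : g = γ * o⁻¹ := by rw [hγ]; group
    obtain ⟨z, hz, hz'⟩ := h1
    refine ⟨γ * z * γ⁻¹, Subgroup.Normal.conj_mem inferInstance z hz γ, ?_⟩
    rw [map_mul, map_mul, hz', h2]
    simp only [Subgroup.subtype_apply, Subgroup.coe_inv]
    group
  have hquot := finite_quotient_of_finiteIndex_root hn K.normalCore hcore
  have hfi : K.normalCore.FiniteIndex := Subgroup.finiteIndex_of_finite_quotient
  have hKfi : K.FiniteIndex := Subgroup.finiteIndex_of_le K.normalCore_le
  have hker : φ.ker.FiniteIndex := by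
    have h1 : K.subgroupOf Γ = φ.ker := by
      ext d
      exact hKmem d.2
    rw [← h1]
    infer_instance
  have : Finite φ.range :=
    Finite.of_equiv _ (QuotientGroup.quotientKerEquivRange φ).toEquiv
  exact Set.toFinite (φ.range : Set Q)

end KeyStep

/-! ### Descent along the subnormal series -/

theorem theorem0p3 {G : Type*} [Group G] (H : Subgroup G) (hH : H.FiniteIndex)
    (s : SubnormalSeries H) (hpos : s.IsPolyPositive) (htors : s.TorsionAbelianFG)
    {R : Type*} [Ring R] (hR : Algebra.FiniteType ℤ R) (n : ℕ) (hn : 3 ≤ n)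
    (Γ : Subgroup (elementaryGroup n R)) (hΓ : Γ.FiniteIndex) (f : Γ →* G) :
    (Set.range f).Finite := by
  have key : ∀ i : Fin (s.length + 1), ((s.term i).comap f).FiniteIndex := by
    intro i
    induction i using Fin.induction with
    | zero =>
      rw [s.term_zero]
      exact H.finiteIndex_comap f
    | succ i ih =>
      have := s.normal i
      let Δ : Subgroup Γ := (s.term i.castSucc).comap f
      let N : Subgroup (s.term i.castSucc) := (s.term i.succ).subgroupOf (s.term i.castSucc)
      let ψ : Δ →* s.Factor i :=
        (QuotientGroup.mk' N).comp (f.subgroupComap (s.term i.castSucc))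
      -- `Δ` is transported to a subgroup of `E_n(R)` in order to apply the one-step result.
      let e : Δ ≃* Δ.map Γ.subtype := Δ.equivMapOfInjective Γ.subtype Γ.subtype_injective
      have hΔ : (Δ.map Γ.subtype).FiniteIndex := by
        refine Subgroup.finiteIndex_of_finiteIndex_subgroupOf (D := Γ) ?_ hΓ ?_
        · rintro _ ⟨γ, -, rfl⟩
          exact γ.2
        · rw [Subgroup.subgroupOf, Subgroup.comap_map_eq_self_of_injective Γ.subtype_injective]
          exact ih
      have hfin := finite_range_of_purelyPositive hR hn (Δ.map Γ.subtype)
        (ψ.comp e.symm.toMonoidHom) (hpos i) (htors i)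
      have hfin' : (Set.range ψ).Finite := by
        refine hfin.subset ?_
        rintro _ ⟨d, rfl⟩
        exact ⟨e d, congrArg ψ (e.symm_apply_apply d)⟩
      have hker := ψ.finiteIndex_ker_of_finite_range hfin'
      have hkereq : ψ.ker = ((s.term i.succ).comap f).subgroupOf Δ := by
        ext d
        exact QuotientGroup.eq_one_iff (N := N) _
      rw [hkereq] at hker
      exact Subgroup.finiteIndex_of_finiteIndex_subgroupOf
        (Subgroup.comap_mono (s.succ_le i)) ih hker
  have hlast : f.ker.FiniteIndex := by
    have := key (Fin.last s.length)
    rwa [s.term_last, MonoidHom.comap_bot] at this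
  have : Finite f.range := Finite.of_equiv _ (QuotientGroup.quotientKerEquivRange f).toEquiv
  exact Set.toFinite (f.range : Set G)
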